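/- **Setting.** For $x=(x_0,x_1,x_2)\in\mathbb R^3$ let $\rho=(x_1^2+x_2^2)^{1/2}$ and let $\phi$ be an azimuth, $x_1=\rho\cos\phi$, $x_2=\rho\sin\phi$. Put $\Phi_m^+(\phi)=\cos(m\phi)$, $\Phi_m^-(\phi)=\sin(m\phi)$, and $(a)_j=a(a+1)\cdots(a+j-1)$, $(a)_0=1$. Let $P_n$ be the Legendre polynomial and $P_n^m$ the associated Legendre functions of the first kind in Hobson's convention: $P_n^m(t)=(-1)^m(1-t^2)^{m/2}P_n^{(m)}(t)$ on $[-1,1]$ and $P_n^m(\cosh v)=\sinh^m v\;P_n^{(m)}(\cosh v)$ (so $P_n^m=0$ if $n<m$). Let $\mu\in[0,1)\cup i\mathbb R^+$. For $\mu\ne0$ and $0\le m\le n$ let $$\widehat U_{n,m}[\mu]=\frac{(n-m)!}{2^n(1/2)_n}\,\mu^n\,P_n^m(\cos u)\,P_n^m(\cosh v),$$ where $(u,v)$ are spheroidal coordinates of $x$: $x_0=\mu\cos u\cosh v$, $\rho=\mu\sin u\sinh v$, $u\in[0,\pi]$, with $v\ge0$ if $\mu>0$ and $v+i\pi/2\ge0$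 if $\mu\in i\mathbb R^+$. For $\mu=0$ let $\widehat U_{n,m}[0]=|x|^nP_n^m(x_0/|x|)$ (extended continuously to $x=0$) for all $n,m\ge0$. The solid harmonics are $U_{n,m}^\pm[\mu](x)=\widehat U_{n,m}[\mu]\,\Phi_m^\pm(\phi)$, and the Garabedian spheroidal harmonics are $$V_{n,m}^\pm[\mu]=\frac{\partial}{\partial x_0}U_{n+1,m}^\pm[\mu],$$ where the sign $-$ is considered only for $m\ge1$. The factor $\widehat V_{n,m}[\mu]$, a function of $(x_0,\rho)$, is the restriction of $V_{n,m}^+[\mu]$ to the half-plane $\phi=0$. **Coefficients.** For $0\le m\le n$ and $0\le 2k\le n$ let $$c_{n,m,k}=\frac{(1/2)_{n-k}\,(n+m-2k+1)_{2k}}{(-4)^k(1/2)_n\,k!},$$ and $c_{n,m,k}=0$ otherwise. Let $v_{n,m,k}=c_{n+1,m,k}$ and $u_{n,m,k}=(n+m-2k+1)\,v_{n,m,k}$. These rational numbers do not depend on $\mu$. **Statement.** Let $0\le m\le n$ and $\mu\in[0,1)\cup i\mathbb R^+$. Then the partial derivatives defining $V_{n,m}^\pm[\mu]$ exist at every point of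 $\mathbb R^3$, $V_{n,m}^\pm[\mu]=\widehat V_{n,m}[\mu]\,\Phi_m^\pm(\phi)$, and $$\widehat V_{n,m}[\mu]=\sum_{0\le 2k\le n-m+1}u_{n,m,k}\,\mu^{2k}\,\widehat U_{n-2k,m}[0],$$ equivalently $$V_{n,m}^\pm[\mu](x)=\sum_{0\le 2k\le n-m+1}u_{n,m,k}\,\mu^{2k}\,U_{n-2k,m}^\pm[0](x)\qquad(x\in\mathbb R^3),$$ where $\mu^0=1$ also for $\mu=0$. (The term with $2k=n-m+1$, if present, is zero: for $m\ge1$ because $P_{m-1}^m=0$, and for $m=0$ because its coefficient is zero, whatever meaning is given to $\widehat U_{-1,0}[0]$.) -/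

import Mathlib

open Polynomial

noncomputable section

namespace Spheroidal

/-- Euclidean three-space, with coordinates `x 0, x 1, x 2`. -/
abbrev R3 : Type := EuclideanSpace ℝ (Fin 3)

/-- The values of the eccentricity parameter `μ = (1 - e^{2ν})^{1/2}`, `ν ∈ ℝ`:
`[0,1) ∪ iℝ⁺` (ball for `μ = 0`, prolate for real `μ > 0`, oblate for imaginary `μ`). -/
def eccentricities : Set ℂ :=
  {μ | (μ.im = 0 ∧ 0 ≤ μ.re ∧ μ.re < 1) ∨ (μ.re = 0 ∧ 0 < μ.im)}

/-- The Legendre polynomial of degree `n` (Rodrigues' formula). -/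
def legendre (n : ℕ) : ℝ[X] :=
  C (1 / (2 ^ n * (n.factorial : ℝ))) * derivative^[n] ((X ^ 2 - 1) ^ n)

/-- The associated Legendre function of the first kind `P_n^m(t)` for `t ∈ [-1,1]`
(Hobson's convention, with the sign `(-1)^m`). It vanishes for `n < m`. -/
def assocLegendre (n m : ℕ) (t : ℝ) : ℝ :=
  (-1) ^ m * Real.sqrt (1 - t ^ 2) ^ m * (derivative^[m] (legendre n)).eval t

/-- The associated Legendre function `P_n^m(z) = (z^2-1)^{m/2} (d/dz)^m P_n(z)` off the
interval `[-1,1]` (Hobson's convention), at `z = cosh v`, where `(z^2-1)^{1/2} = sinh v`. -/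
def assocLegendreCosh (n m : ℕ) (v : ℂ) : ℂ :=
  Complex.sinh v ^ m * aeval (Complex.cosh v) (derivative^[m] (legendre n))

/-- The rising factorial `(a)_j = a (a+1) ⋯ (a+j-1)`. -/
def rising (a : ℚ) (j : ℕ) : ℚ := (ascPochhammer ℚ j).eval a

/-- `(u,v)` are spheroidal coordinates, for the parameter `μ ≠ 0`, of the point with axial
coordinate `a` and distance `ρ ≥ 0` to the axis. In the oblate case `μ = iτ` one has
`v = w - iπ/2` with `w ≥ 0`, that is, `a = τ cos u sinh w` and `ρ = τ sin u cosh w`. -/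
def IsSpheroidalCoord (μ : ℂ) (a ρ : ℝ) (p : ℝ × ℂ) : Prop :=
  p.1 ∈ Set.Icc 0 Real.pi ∧ 0 ≤ p.2.re ∧
    p.2.im = (if μ.im = 0 then 0 else -(Real.pi / 2)) ∧
    (a : ℂ) = μ * Complex.cos p.1 * Complex.cosh p.2 ∧
    (ρ : ℂ) = μ * Complex.sin p.1 * Complex.sinh p.2

/-- Spheroidal coordinates `(u,v)` of the point `(a, ρ)` of the meridian half-plane. -/
def spheroidalCoord (μ : ℂ) (a ρ : ℝ) : ℝ × ℂ :=
  Classical.epsilon (IsSpheroidalCoord μ a ρ)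

/-- The factor `Û_{n,m}[μ](u,v)` for `μ ≠ 0`, in spheroidal coordinates. -/
def UCoord (n m : ℕ) (μ : ℂ) (u : ℝ) (v : ℂ) : ℂ :=
  (((n - m).factorial : ℚ) / (2 ^ n * rising (1 / 2) n) : ℚ) * μ ^ n *
    assocLegendre n m (Real.cos u) * assocLegendreCosh n m v

/-- The factor `Û_{n,m}[μ]` as a function on the meridian half-plane of the points `(a, ρ)`,
`ρ ≥ 0`; for `μ = 0` it is `|x|^n P_n^m(x₀/|x|)`. -/
def UHat (n m : ℕ) (μ : ℂ) (a ρ : ℝ) : ℂ :=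
  open Classical in
  if μ = 0 then
    (Real.sqrt (a ^ 2 + ρ ^ 2) ^ n * assocLegendre n m (a / Real.sqrt (a ^ 2 + ρ ^ 2)) : ℝ)
  else UCoord n m μ (spheroidalCoord μ a ρ).1 (spheroidalCoord μ a ρ).2

/-- The two kinds `+` (cosine) and `-` (sine). -/
inductive Kind : Type
  | plus
  | minus

/-- `Φ_m^+(φ) = cos (mφ)` and `Φ_m^-(φ) = sin (mφ)`. -/
def angular : Kind → ℕ → ℝ → ℝ
  | Kind.plus, m, φ => Real.cos (m * φ)
  | Kind.minus, m, φ => Real.sin (m * φ)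

/-- The distance of `x` to the axis. -/
def axisDist (x : R3) : ℝ := Real.sqrt (x 1 ^ 2 + x 2 ^ 2)

/-- The azimuth `φ`: `x 1 = ρ cos φ`, `x 2 = ρ sin φ` with `ρ = axisDist x`. -/
def azimuth (x : R3) : ℝ := Complex.arg ⟨x 1, x 2⟩

/-- The solid spheroidal harmonics `U_{n,m}^±[μ]` (solid spherical harmonics for `μ = 0`). -/
def U (s : Kind) (n m : ℕ) (μ : ℂ) (x : R3) : ℂ :=
  UHat n m μ (x 0) (axisDist x) * angular s m (azimuth x)

/-- The direction of the axis. -/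
def e0 : R3 := EuclideanSpace.single 0 1

/-- The Garabedian spheroidal harmonics `V_{n,m}^±[μ] = ∂U_{n+1,m}^±[μ]/∂x₀`. -/
def V (s : Kind) (n m : ℕ) (μ : ℂ) (x : R3) : ℂ :=
  lineDeriv ℝ (U s (n + 1) m μ) x e0

/-- The factor `V̂_{n,m}[μ]` in `V_{n,m}^±[μ] = V̂_{n,m}[μ] Φ_m^±(φ)`, as a function on the
meridian half-plane: the values of `V_{n,m}^+[μ]` on the half-plane `φ = 0`. -/
def VHat (n m : ℕ) (μ : ℂ) (a ρ : ℝ) : ℂ := V Kind.plus n m μ !₂[a, ρ, 0]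

/-- The coefficients of the expansion of `U_{n,m}[μ]` in the `U_{n-2k,m}[0]`. -/
def coeffUU (n m k : ℕ) : ℚ :=
  if m ≤ n ∧ 2 * k ≤ n then
    rising (1 / 2) (n - k) * rising ((n : ℚ) + m - 2 * k + 1) (2 * k) /
      ((-4) ^ k * rising (1 / 2) n * (k.factorial : ℚ))
  else 0

/-- The coefficients of the expansion of `V_{n,m}[μ]` in the `V_{n-2k,m}[0]`. -/
def coeffVV (n m k : ℕ) : ℚ := coeffUU (n + 1) m k

/-- The coefficients of the expansion of `V_{n,m}[μ]` in the `U_{n-2k,m}[0]`. -/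
def coeffUV (n m k : ℕ) : ℚ := ((n : ℚ) + m - 2 * k + 1) * coeffVV n m k

end Spheroidal

end

/-! With `t = cos u`, `z = cosh v` one has `x₀ = μtz` and `|x|² = μ²(t² + z² - 1)`, while `ρ^m`
absorbs `sin^m u sinh^m v` and `μ^m`. Writing `H_d(A, Q)` for `homLegendre m d A Q`, `Û_{m+d,m}[0]`
is `(-1)^m ρ^m H_d(x₀, |x|²)`. So expanding `U[μ]` in the `U[0]` amounts to the polynomial identity
`homLegendre_product`, which writes `P^{(m)}(t) P^{(m)}(z)` as a combination of the `H_{d-2k}(tz, t²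
+ z² - 1)`.

Let `L` be the Gegenbauer operator. Both sides satisfy `L_t G = L_z G`: the product because both
factors have the same eigenvalue, each `H` because `ρ^m H Φ_m` is harmonic
(`gegenbauerOp_homLegendre`). A polynomial solution is determined by its values at the singular
point `t = 1` (`eq_zero_of_gegenbauerOp_eq`). There `H_e` becomes a multiple of `z^e`, and the
coefficients of `P^{(m)}(z)` are compared one by one.

Finally `∂/∂x₀` maps `U_{n+1-2k,m}[0]` to `(n+m-2k+1) U_{n-2k,m}[0]` (Appell property,
`derivation_homLegendre_succ`), which turns `v_{n,m,k}` into `u_{n,m,k}`. -/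

noncomputable section

namespace Spheroidal

/-! ### Homogenized derivatives of Legendre polynomials -/

/-- The coefficient of `t ^ e` in `P_n^{(m)}(t)`, where `n = m + 2 * j + e`. -/
def legendreDerivCoeff (m j e : ℕ) : ℝ :=
  (-1) ^ j * (2 * (m + j + e)).factorial /
    (2 ^ (m + 2 * j + e) * j.factorial * (m + j + e).factorial * e.factorial)

/-- The coefficient of `A ^ (d - 2 * j) * Q ^ j` in `homLegendre m d A Q`. -/
def homLegendreCoeff (m d j : ℕ) : ℝ :=
  if 2 * j ≤ d then legendreDerivCoeff m j (d - 2 * j) else 0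

/-- The polynomial `R ^ d * P_{m+d}^{(m)}(A / R)` in `A` and `Q = R ^ 2`. -/
def homLegendre {S : Type*} [CommRing S] [Algebra ℝ S] (m d : ℕ) (A Q : S) : S :=
  ∑ j ∈ Finset.range (d + 1), homLegendreCoeff m d j • (A ^ (d - 2 * j) * Q ^ j)

lemma homLegendreCoeff_of_lt {m d j : ℕ} (h : d < 2 * j) : homLegendreCoeff m d j = 0 :=
  if_neg (by omega)

lemma homLegendreCoeff_add (m j e : ℕ) :
    homLegendreCoeff m (2 * j + e) j = legendreDerivCoeff m j e := by
  rw [homLegendreCoeff, if_pos (by omega), Nat.add_sub_cancel_left]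

lemma map_homLegendre {S S' : Type*} [CommRing S] [Algebra ℝ S] [CommRing S'] [Algebra ℝ S']
    (φ : S →ₐ[ℝ] S') (m d : ℕ) (A Q : S) :
    φ (homLegendre m d A Q) = homLegendre m d (φ A) (φ Q) := by
  simp [homLegendre, map_sum]

lemma homLegendre_smul {S : Type*} [CommRing S] [Algebra ℝ S] (m d : ℕ) (c A Q : S) :
    homLegendre m d (c * A) (c ^ 2 * Q) = c ^ d * homLegendre m d A Q := by
  rw [homLegendre, homLegendre, Finset.mul_sum]
  refine Finset.sum_congr rfl fun j _ => ?_
  by_cases h : 2 * j ≤ d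
  · obtain ⟨e, rfl⟩ := Nat.exists_eq_add_of_le h
    rw [Nat.add_sub_cancel_left, mul_smul_comm]
    congr 1
    ring
  · rw [homLegendreCoeff_of_lt (by omega)]
    simp

/-- The recurrence expressing that `ρ ^ m * homLegendre m d x₀ |x|^2 * Φ_m` is harmonic. -/
lemma legendreDerivCoeff_succ (m j e : ℕ) :
    legendreDerivCoeff m (j + 1) e * ((j + 1) * (2 * (2 * m + 2 * j + 2 * e + 3))) =
      -((e + 2) * (e + 1) * legendreDerivCoeff m j (e + 2)) := by
  have h1 : m + (j + 1) + e = m + j + e + 1 := by ring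
  have h2 : m + j + (e + 2) = m + j + e + 2 := by ring
  have h3 : m + 2 * (j + 1) + e = m + 2 * j + (e + 2) := by ring
  have h4 : 2 * (m + j + e + 1) = 2 * (m + j + e) + 1 + 1 := by ring
  have h5 : 2 * (m + j + e + 2) = 2 * (m + j + e) + 1 + 1 + 1 + 1 := by ring
  simp only [legendreDerivCoeff, h1, h2, h3, h4, h5, Nat.factorial_succ]
  have := Nat.factorial_ne_zero (m + j + e)
  have := Nat.factorial_ne_zero j
  have := Nat.factorial_ne_zero e
  push_cast
  field_simp
  ring

lemma homLegendreCoeff_succ (m d j : ℕ) :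
    homLegendreCoeff m d (j + 1) *
        ((j + 1) * (2 * (2 * m + 2 * j + 2 * (d - 2 * j - 2 : ℕ) + 3))) =
      -((d - 2 * j : ℕ) * ((d - 2 * j - 1 : ℕ) : ℝ) * homLegendreCoeff m d j) := by
  by_cases h : 2 * (j + 1) ≤ d
  · obtain ⟨e, rfl⟩ := Nat.exists_eq_add_of_le h
    rw [homLegendreCoeff_add, show 2 * (j + 1) + e = 2 * j + (e + 2) by ring,
      homLegendreCoeff_add, Nat.add_sub_cancel_left, show e + 2 - 2 = e by omega,
      show e + 2 - 1 = e + 1 by omega, legendreDerivCoeff_succ]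
    push_cast
    ring
  · rw [homLegendreCoeff_of_lt (by omega)]
    -- Truncated subtraction kills the right side, so the recurrence holds at the end of the range
    -- too.
    have : d - 2 * j = 0 ∨ d - 2 * j - 1 = 0 := by omega
    rcases this with h | h <;> simp [h]

/-- Coefficient comparison in `(∂_A + 2A ∂_Q) H_{d+1} = (2m+d+1) H_d`, for `d = 2j+e+1`. The next
lemma is the boundary case `d = 2j`. -/
lemma legendreDerivCoeff_appell (m j e : ℕ) :
    (e + 2) * legendreDerivCoeff m j (e + 2) +
        2 * (j + 1) * legendreDerivCoeff m (j + 1) e =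
      (2 * m + 2 * j + e + 2) * legendreDerivCoeff m j (e + 1) := by
  have h1 : m + (j + 1) + e = m + j + e + 1 := by ring
  have h2 : m + j + (e + 2) = m + j + e + 2 := by ring
  have h3 : m + 2 * (j + 1) + e = m + 2 * j + e + 2 := by ring
  have h4 : 2 * (m + j + e + 1) = 2 * (m + j + e) + 1 + 1 := by ring
  have h5 : 2 * (m + j + e + 2) = 2 * (m + j + e) + 1 + 1 + 1 + 1 := by ring
  have h6 : m + j + (e + 1) = m + j + e + 1 := by ring
  simp only [legendreDerivCoeff, h1, h2, h3, h4, h5, h6, Nat.factorial_succ]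
  have := Nat.factorial_ne_zero (m + j + e)
  have := Nat.factorial_ne_zero j
  have := Nat.factorial_ne_zero e
  push_cast
  field_simp
  ring

lemma legendreDerivCoeff_appell_zero (m j : ℕ) :
    legendreDerivCoeff m j 1 = (2 * m + 2 * j + 1) * legendreDerivCoeff m j 0 := by
  have h5 : 2 * (m + j + 1) = 2 * (m + j) + 1 + 1 := by ring
  simp only [legendreDerivCoeff, h5, Nat.factorial_succ, add_zero]
  have := Nat.factorial_ne_zero (m + j)
  have := Nat.factorial_ne_zero j
  push_cast
  field_simp
  ring

lemma homLegendreCoeff_appell (m d j : ℕ) :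
    ((d + 1 - 2 * j : ℕ) : ℝ) * homLegendreCoeff m (d + 1) j +
        2 * (j + 1) * homLegendreCoeff m (d + 1) (j + 1) =
      (2 * m + d + 1) * homLegendreCoeff m d j := by
  rcases lt_trichotomy d (2 * j) with h | rfl | h
  · rw [homLegendreCoeff_of_lt h, homLegendreCoeff_of_lt (j := j + 1) (by omega),
      show d + 1 - 2 * j = 0 by omega]
    simp
  · rw [homLegendreCoeff_add, homLegendreCoeff_of_lt (j := j + 1) (by omega),
      show 2 * j = 2 * j + 0 by ring, homLegendreCoeff_add,
      legendreDerivCoeff_appell_zero, show 2 * j + 0 + 1 - (2 * j + 0) = 1 by omega]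
    push_cast
    ring
  · obtain ⟨e, rfl⟩ := Nat.exists_eq_add_of_lt h
    rw [show 2 * j + e + 1 = 2 * j + (e + 1) by ring, homLegendreCoeff_add,
      show 2 * j + (e + 1) + 1 = 2 * j + (e + 2) by ring, homLegendreCoeff_add,
      show 2 * j + (e + 2) = 2 * (j + 1) + e by ring, homLegendreCoeff_add,
      show 2 * (j + 1) + e - 2 * j = e + 2 by omega]
    have := legendreDerivCoeff_appell m j e
    push_cast
    linear_combination this

/-- The Appell property, for a derivation with `D A = 1` and `D Q = 2 * A`. -/
lemma derivation_homLegendre_succ {S : Type*} [CommRing S] [Algebra ℝ S] (D : Derivation ℝ S S)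
    (m d : ℕ) (A Q : S) (hA : D A = 1) (hQ : D Q = 2 * A) :
    D (homLegendre m (d + 1) A Q) = (2 * m + d + 1 : ℝ) • homLegendre m d A Q := by
  have key : ∀ j, D (A ^ (d + 1 - 2 * j) * Q ^ j) =
      ((d + 1 - 2 * j : ℕ) : ℝ) • (A ^ (d - 2 * j) * Q ^ j) +
        (2 * j : ℝ) • (A ^ (d + 1 - 2 * j + 1) * Q ^ (j - 1)) := by
    intro j
    rw [Derivation.leibniz, Derivation.leibniz_pow, Derivation.leibniz_pow, hA, hQ,
      show d + 1 - 2 * j - 1 = d - 2 * j by omega]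
    simp only [smul_eq_mul, nsmul_eq_mul]
    simp only [Algebra.smul_def, map_mul, map_natCast, map_ofNat]
    ring
  simp only [homLegendre, map_sum, Derivation.map_smul, key, smul_add, Finset.sum_add_distrib,
    smul_smul, Finset.smul_sum]
  -- The last term of the first sum and the `j = 0` term of the second vanish; the second is then
  -- shifted by one.
  rw [Finset.sum_range_succ, Finset.sum_range_succ' (n := d + 1),
    show d + 1 - 2 * (d + 1) = 0 by omega]
  simp only [CharP.cast_eq_zero, mul_zero, zero_smul, add_zero]
  rw [← Finset.sum_add_distrib]
  refine Finset.sum_congr rfl fun j _ => ?_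
  rw [← homLegendreCoeff_appell]
  by_cases h : d + 1 < 2 * (j + 1)
  · rw [homLegendreCoeff_of_lt h]
    simp [mul_comm]
  · rw [show d + 1 - 2 * (j + 1) + 1 = d - 2 * j by omega, Nat.add_sub_cancel, ← add_smul]
    congr 1
    push_cast
    ring

lemma iterate_derivative_legendre (m d : ℕ) :
    derivative^[m] (legendre (m + d)) = homLegendre m d X 1 := by
  rw [legendre, iterate_derivative_C_mul, ← Function.iterate_add_apply,
    show (X ^ 2 - 1 : ℝ[X]) = -1 + X ^ 2 by ring, add_pow, iterate_derivative_sum, Finset.mul_sum,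
    homLegendre, ← Finset.sum_subset (s₁ := Finset.range (d + 1))
      (Finset.range_mono (by omega : d + 1 ≤ m + d + 1))]
  · refine Finset.sum_congr rfl fun j hj => ?_
    rw [Finset.mem_range] at hj
    rw [show (-1 : ℝ[X]) ^ j * (X ^ 2) ^ (m + d - j) * ((m + d).choose j : ℝ[X]) =
      C ((-1) ^ j * ((m + d).choose j : ℝ)) * X ^ (2 * (m + d - j)) by
        simp [← pow_mul]; ring, iterate_derivative_C_mul, iterate_derivative_X_pow_eq_smul]
    by_cases h : 2 * j ≤ d
    · obtain ⟨e, rfl⟩ := Nat.exists_eq_add_of_le h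
      rw [homLegendreCoeff_add, legendreDerivCoeff, one_pow, mul_one, smul_eq_C_mul, smul_eq_C_mul,
        ← mul_assoc, ← mul_assoc, ← C_mul, ← C_mul,
        show 2 * (m + (2 * j + e) - j) - (m + (m + (2 * j + e))) = e by omega,
        show 2 * j + e - 2 * j = e by omega]
      congr 2
      have h1 : ((m + (2 * j + e)).choose j : ℝ) =
          (m + (2 * j + e)).factorial / (j.factorial * (m + j + e).factorial) := by
        rw [Nat.cast_choose ℝ (by omega), show m + (2 * j + e) - j = m + j + e by omega]
      have h2 : ((2 * (m + (2 * j + e) - j)).descFactorial (m + (m + (2 * j + e))) : ℝ) =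
          (2 * (m + j + e)).factorial / e.factorial := by
        rw [eq_div_iff (by positivity), show m + (2 * j + e) - j = m + j + e by omega,
          ← Nat.factorial_mul_descFactorial
            (by omega : m + (m + (2 * j + e)) ≤ 2 * (m + j + e)),
          show 2 * (m + j + e) - (m + (m + (2 * j + e))) = e by omega]
        push_cast
        ring
      rw [h1, h2]
      have := Nat.factorial_ne_zero (m + (2 * j + e))
      field_simp
      ring
    -- Here the degree `2(m+d-j)` is less than the number `2m+d` of derivatives.
    · rw [homLegendreCoeff_of_lt (by omega), Nat.descFactorial_of_lt (by omega)]
      simp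
  · intro j hj' hj
    rw [Finset.mem_range] at hj hj'
    rw [show (-1 : ℝ[X]) ^ j * (X ^ 2) ^ (m + d - j) * ((m + d).choose j : ℝ[X]) =
      C ((-1) ^ j * ((m + d).choose j : ℝ)) * X ^ (2 * (m + d - j)) by
        simp [← pow_mul]; ring, iterate_derivative_C_mul, iterate_derivative_X_pow_eq_smul,
      Nat.descFactorial_of_lt (by omega)]
    simp

lemma iterate_derivative_legendre_of_lt {n m : ℕ} (h : n < m) :
    derivative^[m] (legendre n) = 0 := by
  -- The `n`-th derivative of `P_n` is constant, so one more derivative gives zero.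
  obtain ⟨k, rfl⟩ := Nat.exists_eq_add_of_lt h
  have h0 := iterate_derivative_legendre n 0
  have h1 : homLegendre n 0 (X : ℝ[X]) 1 = C (homLegendreCoeff n 0 0) := by
    simp [homLegendre, smul_eq_C_mul]
  rw [add_zero, h1] at h0
  rw [show n + k + 1 = k + (1 + n) by ring, Function.iterate_add_apply, Function.iterate_add_apply,
    h0]
  simp

/-! ### Differential equation for the derivatives of Legendre polynomials -/

lemma rodrigues_ode_zero (n : ℕ) :
    (X ^ 2 - 1 : ℝ[X]) * derivative (derivative ((X ^ 2 - 1) ^ n)) +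
        C (2 * (1 - n) : ℝ) * X * derivative ((X ^ 2 - 1) ^ n) +
        C (-2 * n : ℝ) * (X ^ 2 - 1) ^ n = 0 := by
  have h2 : (C 2 : ℝ[X]) = 2 := map_ofNat C 2
  have h : (X ^ 2 - 1 : ℝ[X]) * derivative ((X ^ 2 - 1) ^ n) =
      2 * (n : ℝ[X]) * X * (X ^ 2 - 1) ^ n := by
    rcases n with _ | n
    · simp
    · rw [derivative_pow]
      simp
      ring
  have := congrArg derivative h
  simp [derivative_mul] at this
  simp [h2]
  linear_combination this

lemma rodrigues_ode (n j : ℕ) :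
    (X ^ 2 - 1 : ℝ[X]) * derivative^[j + 2] ((X ^ 2 - 1) ^ n) +
        C (2 * (j + 1 - n) : ℝ) * X * derivative^[j + 1] ((X ^ 2 - 1) ^ n) +
        C ((j + 1) * (j - 2 * n) : ℝ) * derivative^[j] ((X ^ 2 - 1) ^ n) = 0 := by
  have h2 : (C 2 : ℝ[X]) = 2 := map_ofNat C 2
  generalize hy : ((X ^ 2 - 1) ^ n : ℝ[X]) = y
  induction j with
  | zero =>
    have h := rodrigues_ode_zero n
    rw [hy] at h
    simp only [Function.iterate_succ_apply', Function.iterate_zero, id]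
    simp [h2] at h ⊢
    linear_combination h
  | succ j ih =>
    have := congrArg derivative ih
    rw [derivative_zero, derivative_add, derivative_add, derivative_mul, mul_assoc,
      derivative_C_mul, derivative_C_mul, derivative_mul,
      ← Function.iterate_succ_apply' (⇑derivative), ← Function.iterate_succ_apply' (⇑derivative),
      ← Function.iterate_succ_apply' (⇑derivative)] at this
    simp only [Nat.succ_eq_add_one, add_assoc, Nat.reduceAdd] at this ⊢
    generalize derivative^[j + 3] y = y3 at this ⊢
    generalize derivative^[j + 2] y = y2 at this ⊢
    generalize derivative^[j + 1] y = y1 at this ⊢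
    simp [h2] at this ⊢
    linear_combination this

/-- The Gegenbauer differential equation. -/
lemma homLegendre_ode (m d : ℕ) :
    (1 - X ^ 2 : ℝ[X]) * derivative (derivative (homLegendre m d X 1)) -
        C (2 * (m + 1) : ℝ) * X * derivative (homLegendre m d X 1) +
        C (d * (2 * m + d + 1) : ℝ) * homLegendre m d X 1 = 0 := by
  -- After `2m+d` derivatives of `(X²-1)^(m+d)` the coefficients become `2(m+1)` and `-d(2m+d+1)`.
  have h := rodrigues_ode (m + d) (m + (m + d))
  rw [← iterate_derivative_legendre, legendre, iterate_derivative_C_mul,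
    ← Function.iterate_add_apply, derivative_C_mul, derivative_C_mul,
    ← Function.iterate_succ_apply' (⇑derivative), ← Function.iterate_succ_apply' (⇑derivative)]
  have h2 : (C 2 : ℝ[X]) = 2 := map_ofNat C 2
  simp [h2] at h ⊢
  linear_combination (-C ((m + d).factorial : ℝ)⁻¹ * C (2 ^ (m + d) : ℝ)⁻¹) * h

/-! ### Values on the axis -/

/-- The case `Q = A²` is the axis `ρ = 0`; homogeneity reduces it to `A = Q = 1`. -/
lemma homLegendre_X_sq {S : Type*} [CommRing S] [Algebra ℝ S] (m d : ℕ) (A : S) :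
    homLegendre m d A (A ^ 2) = algebraMap ℝ S (homLegendre m d 1 1) * A ^ d := by
  have h := homLegendre_smul m d A (1 : S) 1
  have h' := map_homLegendre (Algebra.ofId ℝ S) m d 1 1
  rw [map_one] at h'
  rw [mul_one, mul_one, ← h'] at h
  rw [h, mul_comm]
  rfl

lemma homLegendre_one_one (m d : ℕ) :
    homLegendre m d (1 : ℝ) 1 =
      (2 * m + d).factorial / (d.factorial * 2 ^ m * m.factorial) := by
  induction d with
  | zero => simp [homLegendre, homLegendreCoeff, legendreDerivCoeff]
  | succ d ih =>
    -- On the axis the Appell property reads `(d+1) H_{d+1}(1,1) = (2m+d+1) H_d(1,1)`.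
    have h := derivation_homLegendre_succ (derivative' (R := ℝ)) m d X (X ^ 2) (by simp) (by
      simp)
    rw [homLegendre_X_sq, homLegendre_X_sq] at h
    have h1 := congrArg (eval 1) h
    simp [ih] at h1
    have h2 : (d + 1 : ℝ) ≠ 0 := by positivity
    refine mul_right_cancel₀ h2 ?_
    rw [h1, ← add_assoc, Nat.factorial_succ,
      Nat.factorial_succ]
    have := Nat.factorial_ne_zero d
    push_cast
    field_simp

/-! ### Separation of variables -/

/-- The Gegenbauer operator `(1 - T ^ 2) D ^ 2 - 2 (m + 1) T D`. -/
def gegenbauerOp {S : Type*} [CommRing S] [Algebra ℝ S] (m : ℕ) (D : Derivation ℝ S S) (T : S) :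
    S →ₗ[ℝ] S :=
  LinearMap.mulLeft ℝ (1 - T ^ 2) ∘ₗ (D : S →ₗ[ℝ] S) ∘ₗ (D : S →ₗ[ℝ] S) -
    LinearMap.mulLeft ℝ (2 * (m + 1) * T) ∘ₗ (D : S →ₗ[ℝ] S)

lemma gegenbauerOp_apply {S : Type*} [CommRing S] [Algebra ℝ S] (m : ℕ) (D : Derivation ℝ S S)
    (T G : S) : gegenbauerOp m D T G = (1 - T ^ 2) * D (D G) - 2 * (m + 1) * T * D G := rfl

lemma gegenbauerOp_aeval {S : Type*} [CommRing S] [Algebra ℝ S] (m d : ℕ)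
    (D : Derivation ℝ S S) (T c : S) (hT : D T = 1) (hc : D c = 0) :
    gegenbauerOp m D T (aeval T (homLegendre m d (X : ℝ[X]) 1) * c) =
      -(algebraMap ℝ S (d * (2 * m + d + 1)) * (aeval T (homLegendre m d (X : ℝ[X]) 1) * c)) := by
  have h := congrArg (fun p : ℝ[X] => aeval T p) (homLegendre_ode m d)
  simp only [gegenbauerOp_apply, Derivation.leibniz, Derivation.map_aeval, hT, hc, smul_eq_mul,
    mul_one, mul_zero, zero_add, add_zero]
  simp only [map_add, map_sub, map_mul, map_one, map_zero, map_pow, aeval_X, map_natCast,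
    map_ofNat] at h ⊢
  linear_combination c * h

lemma gegenbauerOp_mul_pow {S : Type*} [CommRing S] [Algebra ℝ S] (m i j : ℕ)
    (D : Derivation ℝ S S) (T Z A Q : S) (hT : D T = 1) (hZ : D Z = 0) (hA : D A = Z)
    (hQ : D Q = 2 * T) :
    gegenbauerOp m D T (A ^ i * Q ^ j) =
      (1 - T ^ 2) * (Z ^ 2 * (i * (i - 1 : ℕ) * A ^ (i - 2)) * Q ^ j +
        4 * T * Z * (i * A ^ (i - 1)) * (j * Q ^ (j - 1)) +
        4 * T ^ 2 * A ^ i * (j * (j - 1 : ℕ) * Q ^ (j - 2)) + 2 * A ^ i * (j * Q ^ (j - 1))) -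
      2 * (m + 1) * T * (Z * (i * A ^ (i - 1)) * Q ^ j + 2 * T * A ^ i * (j * Q ^ (j - 1))) := by
  have h2 : D 2 = 0 := by exact_mod_cast D.map_natCast 2
  simp only [gegenbauerOp_apply, Derivation.leibniz, Derivation.leibniz_pow, hA, hQ, hT, hZ,
    smul_eq_mul, nsmul_eq_mul, map_add, Derivation.map_natCast, Nat.sub_sub, h2]
  ring

/-- The Laplacian separated in spheroidal coordinates: `Z² - T²` is the metric factor, and the
bracket is what the Laplacian makes of `ρ^m A^i Q^j Φ_m`, with `A = x₀`, `Q = |x|²`. -/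
lemma gegenbauerOp_sub_mul_pow {S : Type*} [CommRing S] [Algebra ℝ S] (m i j : ℕ)
    (D E : Derivation ℝ S S) (T Z : S) (hDT : D T = 1) (hDZ : D Z = 0) (hET : E T = 0)
    (hEZ : E Z = 1) :
    gegenbauerOp m D T ((T * Z) ^ i * (T ^ 2 + Z ^ 2 - 1) ^ j) -
        gegenbauerOp m E Z ((T * Z) ^ i * (T ^ 2 + Z ^ 2 - 1) ^ j) =
      (Z ^ 2 - T ^ 2) *
        ((i * (i - 1 : ℕ) : ℝ) • ((T * Z) ^ (i - 2) * (T ^ 2 + Z ^ 2 - 1) ^ j) +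
          (j * (2 * (2 * m + 2 * i + 2 * j + 1)) : ℝ) •
            ((T * Z) ^ i * (T ^ 2 + Z ^ 2 - 1) ^ (j - 1))) := by
  rw [gegenbauerOp_mul_pow m i j D T Z _ _ hDT hDZ (by simp [hDT, hDZ])
      (by simp [Derivation.leibniz_pow, hDT, hDZ]),
    gegenbauerOp_mul_pow m i j E Z T _ _ hEZ hET (by simp [hET, hEZ])
      (by simp [Derivation.leibniz_pow, hET, hEZ])]
  have hi : (T * Z) * (i * (T * Z) ^ (i - 1)) = i * (T * Z) ^ i := by
    rcases i with _ | i
    · simp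
    · simp [pow_succ]
      ring
  have hj : (T ^ 2 + Z ^ 2 - 1) * (j * (j - 1 : ℕ) * (T ^ 2 + Z ^ 2 - 1) ^ (j - 2)) =
      (j - 1) * (j * (T ^ 2 + Z ^ 2 - 1) ^ (j - 1)) := by
    rcases j with _ | _ | j
    · simp
    · simp
    · simp [pow_succ]
      ring
  simp only [Algebra.smul_def, map_mul, map_add, map_natCast, map_ofNat, map_one]
  generalize (j : S) * (j - 1 : ℕ) * (T ^ 2 + Z ^ 2 - 1) ^ (j - 2) = q2 at *
  generalize (T ^ 2 + Z ^ 2 - 1) ^ (j - 1) = q1 at *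
  generalize (T ^ 2 + Z ^ 2 - 1) ^ j = q at *
  generalize (T * Z) ^ (i - 1) = p1 at *
  generalize (T * Z) ^ (i - 2) = p2 at *
  generalize (T * Z) ^ i = p at *
  linear_combination 4 * (Z ^ 2 - T ^ 2) * (j * q1) * hi + 4 * (Z ^ 2 - T ^ 2) * p * hj

lemma gegenbauerOp_homLegendre {S : Type*} [CommRing S] [Algebra ℝ S] (m d : ℕ)
    (D E : Derivation ℝ S S) (T Z : S) (hDT : D T = 1) (hDZ : D Z = 0) (hET : E T = 0)
    (hEZ : E Z = 1) :
    gegenbauerOp m D T (homLegendre m d (T * Z) (T ^ 2 + Z ^ 2 - 1)) =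
      gegenbauerOp m E Z (homLegendre m d (T * Z) (T ^ 2 + Z ^ 2 - 1)) := by
  rw [← sub_eq_zero]
  simp only [homLegendre, map_sum, map_smul]
  rw [← Finset.sum_sub_distrib]
  simp only [← smul_sub, gegenbauerOp_sub_mul_pow m _ _ D E T Z hDT hDZ hET hEZ,
    ← mul_smul_comm]
  rw [← Finset.mul_sum]
  refine mul_eq_zero_of_right _ ?_
  simp only [smul_add, Finset.sum_add_distrib, mul_smul_comm, smul_smul]
  -- The first part at index `j` cancels the second at `j + 1`; the two unmatched end terms are
  -- zero.
  rw [Finset.sum_range_succ, Finset.sum_range_succ' (n := d)]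
  have h0 : d - 2 * d = 0 := by omega
  simp only [h0, CharP.cast_eq_zero, mul_zero, zero_mul, zero_smul, add_zero]
  rw [← Finset.sum_add_distrib]
  refine Finset.sum_eq_zero fun j _ => ?_
  have h := homLegendreCoeff_succ m d j
  rw [Nat.add_sub_cancel, show d - 2 * (j + 1) = d - 2 * j - 2 by omega, ← add_smul]
  convert zero_smul ℝ _ using 2
  push_cast
  linear_combination h

/-! ### Uniqueness -/

/-- Differentiation with respect to the inner variable of `ℝ[X][X]`. -/
def innerDerivative : Derivation ℝ ℝ[X][X] ℝ[X][X] :=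
  (PolynomialModule.equivPolynomialSelf (R := ℝ[X])).toLinearMap.compDer
    (derivative' (R := ℝ)).mapCoeffs

lemma coeff_innerDerivative (G : ℝ[X][X]) (j : ℕ) :
    (innerDerivative G).coeff j = derivative (G.coeff j) := rfl

/-- Differentiation with respect to the outer variable of `ℝ[X][X]`. -/
def outerDerivative : Derivation ℝ ℝ[X][X] ℝ[X][X] :=
  (derivative' (R := ℝ[X])).restrictScalars ℝ

lemma outerDerivative_apply (G : ℝ[X][X]) : outerDerivative G = derivative G := rfl

/-- Taking `T = X + 1` moves the singular point `T = 1` to `X = 0`, where `1 - T² = -(X² + 2X)`;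
hence a two-term recurrence. -/
lemma coeff_gegenbauerOp_outer (m : ℕ) (G : ℝ[X][X]) (j : ℕ) :
    (gegenbauerOp m outerDerivative (X + 1) G).coeff j =
      -(2 * ((j + 1) * (j + m + 1)) * G.coeff (j + 1) + j * (j + 2 * m + 1) * G.coeff j) := by
  have h : gegenbauerOp m outerDerivative (X + 1) G =
      -(X * (X * derivative (derivative G)) + ((2 : ℕ) : ℝ[X][X]) * (X * derivative (derivative G)) +
        ((2 * (m + 1) : ℕ) : ℝ[X][X]) * (X * derivative G + derivative G)) := by
    rw [gegenbauerOp_apply, outerDerivative_apply, outerDerivative_apply]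
    push_cast
    ring
  rw [h]
  rcases j with _ | _ | j <;>
  · simp only [coeff_neg, coeff_add, coeff_natCast_mul, coeff_X_mul,
      coeff_derivative, mul_coeff_zero, coeff_X_zero, coeff_natCast_ite, if_true]
    push_cast
    ring

/-- The inner operator acts coefficientwise, and the factor `2(j+1)(j+m+1)` of the next coefficient
never vanishes. -/
lemma eq_zero_of_gegenbauerOp_eq (m : ℕ) (G : ℝ[X][X])
    (h : gegenbauerOp m outerDerivative (X + 1) G = gegenbauerOp m innerDerivative (C X) G)
    (h0 : G.coeff 0 = 0) : G = 0 := by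
  ext1 j
  rw [coeff_zero]
  induction j with
  | zero => exact h0
  | succ j ih =>
    have h1 := congrArg (fun H => coeff H j) h
    have h2 : gegenbauerOp m innerDerivative (C X) G =
        C (1 - X ^ 2) * innerDerivative (innerDerivative G) -
          C (2 * (m + 1) * X) * innerDerivative G := by
      simp [gegenbauerOp_apply, show (C 2 : ℝ[X][X]) = 2 from map_ofNat C 2]
    simp only [coeff_gegenbauerOp_outer, h2, coeff_sub, coeff_C_mul, coeff_innerDerivative, ih,
      derivative_zero, mul_zero, sub_zero, add_zero, neg_eq_zero, mul_eq_zero] at h1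
    rcases h1 with (h1 | h1 | h1) | h1
    · norm_num at h1
    · exact absurd h1 (by exact_mod_cast Nat.succ_ne_zero j)
    · exact absurd h1 (by exact_mod_cast Nat.succ_ne_zero (j + m))
    · exact h1

/-! ### The expansion of a product of Legendre functions -/

lemma rising_half (n : ℕ) :
    rising (1 / 2) n = (2 * n).factorial / (4 ^ n * n.factorial) := by
  induction n with
  | zero => simp [rising]
  | succ n ih =>
    rw [rising] at ih ⊢
    rw [ascPochhammer_succ_eval, ih, show 2 * (n + 1) = 2 * n + 1 + 1 by ring,
      Nat.factorial_succ, Nat.factorial_succ, Nat.factorial_succ]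
    have := Nat.factorial_ne_zero n
    push_cast
    field_simp
    ring

lemma rising_natCast_add_one (n j : ℕ) :
    rising (n + 1) j = (n + j).factorial / n.factorial := by
  induction j with
  | zero =>
    have := Nat.factorial_ne_zero n
    simp [rising]
    field_simp
  | succ j ih =>
    rw [rising] at ih ⊢
    rw [ascPochhammer_succ_eval, ih, ← add_assoc, Nat.factorial_succ]
    push_cast
    ring

/-- The normalizing factor of `UCoord (m + d) m`. -/
def normFactor (m d : ℕ) : ℚ := (d.factorial : ℚ) / (2 ^ (m + d) * rising (1 / 2) (m + d))

lemma coeffUU_eq (m k e : ℕ) :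
    (coeffUU (m + (2 * k + e)) m k : ℝ) =
      (-1) ^ k * (2 * (m + k + e)).factorial * (m + 2 * k + e).factorial *
          (2 * m + e + 2 * k).factorial /
        ((m + k + e).factorial * (2 * (m + 2 * k + e)).factorial * (2 * m + e).factorial *
          k.factorial) := by
  have h : coeffUU (m + (2 * k + e)) m k =
      (-1) ^ k * (2 * (m + k + e)).factorial * (m + 2 * k + e).factorial *
          (2 * m + e + 2 * k).factorial /
        ((m + k + e).factorial * (2 * (m + 2 * k + e)).factorial * (2 * m + e).factorial *
          k.factorial) := by
    rw [coeffUU, if_pos (by omega), show m + (2 * k + e) - k = m + k + e by omega,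
      show ((m + (2 * k + e) : ℕ) : ℚ) + m - 2 * k + 1 = (2 * m + e : ℕ) + 1 by push_cast; ring,
      rising_natCast_add_one, rising_half, rising_half, show m + (2 * k + e) = m + 2 * k + e by ring]
    have := Nat.factorial_ne_zero (m + k + e)
    have := Nat.factorial_ne_zero (m + 2 * k + e)
    have := Nat.factorial_ne_zero (2 * (m + 2 * k + e))
    have := Nat.factorial_ne_zero (2 * m + e)
    have := Nat.factorial_ne_zero k
    rw [show (-4 : ℚ) ^ k = (-1) ^ k * 4 ^ k by rw [← mul_pow]; norm_num]
    have h1 : ((-1 : ℚ) ^ k) * (-1) ^ k = 1 := by rw [← mul_pow]; norm_num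
    have h2 : ((-1 : ℚ) ^ k) ≠ 0 := by positivity
    have h3 : (4 : ℚ) ^ (m + 2 * k + e) = 4 ^ (m + k + e) * 4 ^ k := by
      rw [← pow_add]
      congr 1
      ring
    rw [h3]
    field_simp
    linear_combination -h1
  rw [h]
  push_cast
  rfl

/-- The coefficient comparison on the axis. -/
lemma normFactor_mul_legendreDerivCoeff (m k e : ℕ) :
    (normFactor m (2 * k + e) : ℝ) * homLegendre m (2 * k + e) (1 : ℝ) 1 *
        legendreDerivCoeff m k e =
      coeffUU (m + (2 * k + e)) m k * homLegendre m e (1 : ℝ) 1 := by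
  rw [coeffUU_eq, homLegendre_one_one, homLegendre_one_one, normFactor, rising_half,
    legendreDerivCoeff, show m + (2 * k + e) = m + 2 * k + e by ring,
    show 2 * m + (2 * k + e) = 2 * m + e + 2 * k by ring]
  have := Nat.factorial_ne_zero (m + k + e)
  have := Nat.factorial_ne_zero (m + 2 * k + e)
  have := Nat.factorial_ne_zero (2 * (m + 2 * k + e))
  have := Nat.factorial_ne_zero (2 * m + e)
  have := Nat.factorial_ne_zero (2 * k + e)
  have := Nat.factorial_ne_zero k
  have := Nat.factorial_ne_zero e
  push_cast
  rw [show (4 : ℝ) ^ (m + 2 * k + e) = 2 ^ (m + 2 * k + e) * 2 ^ (m + 2 * k + e) by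
    rw [← mul_pow]; norm_num]
  field_simp

lemma homLegendre_eq_sum {S : Type*} [CommRing S] [Algebra ℝ S] (m d : ℕ) (A Q : S) :
    homLegendre m d A Q =
      ∑ j ∈ Finset.range (d / 2 + 1), homLegendreCoeff m d j • (A ^ (d - 2 * j) * Q ^ j) := by
  refine (Finset.sum_subset (Finset.range_mono (by omega)) fun j _ hj => ?_).symm
  rw [Finset.mem_range] at hj
  rw [homLegendreCoeff_of_lt (by omega), zero_smul]

/-- This holds for arbitrary `r` and `c k`; only the comparison at `T = 1` fixes them. -/
lemma gegenbauerOp_product_sub {S : Type*} [CommRing S] [Algebra ℝ S] (m d : ℕ)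
    (D E : Derivation ℝ S S) (T Z : S) (hDT : D T = 1) (hDZ : D Z = 0) (hET : E T = 0)
    (hEZ : E Z = 1) (r : ℝ) (s : Finset ℕ) (c : ℕ → ℝ) (i : ℕ → ℕ) :
    gegenbauerOp m D T (r • (aeval T (homLegendre m d (X : ℝ[X]) 1) *
        aeval Z (homLegendre m d (X : ℝ[X]) 1)) -
          ∑ k ∈ s, c k • homLegendre m (i k) (T * Z) (T ^ 2 + Z ^ 2 - 1)) =
      gegenbauerOp m E Z (r • (aeval T (homLegendre m d (X : ℝ[X]) 1) *
        aeval Z (homLegendre m d (X : ℝ[X]) 1)) -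
          ∑ k ∈ s, c k • homLegendre m (i k) (T * Z) (T ^ 2 + Z ^ 2 - 1)) := by
  simp only [map_sub, map_smul, map_sum, gegenbauerOp_homLegendre m _ _ _ _ _ hDT hDZ hET hEZ]
  congr 2
  rw [gegenbauerOp_aeval m d _ _ _ hDT (by rw [Derivation.map_aeval, hDZ, smul_zero]),
    mul_comm (aeval T _),
    gegenbauerOp_aeval m d _ _ _ hEZ (by rw [Derivation.map_aeval, hET, smul_zero])]

lemma map_product_sub {S S' : Type*} [CommRing S] [Algebra ℝ S] [CommRing S'] [Algebra ℝ S']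
    (φ : S →ₐ[ℝ] S') (m d : ℕ) (T Z : S) (r : ℝ) (s : Finset ℕ) (c : ℕ → ℝ) (i : ℕ → ℕ) :
    φ (r • (aeval T (homLegendre m d (X : ℝ[X]) 1) *
        aeval Z (homLegendre m d (X : ℝ[X]) 1)) -
          ∑ k ∈ s, c k • homLegendre m (i k) (T * Z) (T ^ 2 + Z ^ 2 - 1)) =
      r • (homLegendre m d (φ T) 1 * homLegendre m d (φ Z) 1) -
          ∑ k ∈ s, c k • homLegendre m (i k) (φ T * φ Z) (φ T ^ 2 + φ Z ^ 2 - 1) := by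
  simp only [map_sub, map_smul, map_sum, map_mul, aeval_X, map_homLegendre, map_add,
    map_pow, map_one]

lemma homLegendre_product_axis (m d : ℕ) :
    (normFactor m d : ℝ) • (homLegendre m d (1 : ℝ[X]) 1 * homLegendre m d X 1) =
      ∑ k ∈ Finset.range (d / 2 + 1), (coeffUU (m + d) m k : ℝ) •
        homLegendre m (d - 2 * k) (1 * X : ℝ[X]) (1 ^ 2 + X ^ 2 - 1) := by
  have h1 : homLegendre m d (1 : ℝ[X]) 1 = algebraMap ℝ ℝ[X] (homLegendre m d 1 1) := by
    have := homLegendre_X_sq m d (1 : ℝ[X])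
    rwa [one_pow, one_pow, mul_one] at this
  rw [h1, homLegendre_eq_sum m d X, Finset.mul_sum, Finset.smul_sum]
  refine Finset.sum_congr rfl fun k hk => ?_
  rw [Finset.mem_range] at hk
  obtain ⟨e, rfl⟩ := Nat.exists_eq_add_of_le (by omega : 2 * k ≤ d)
  rw [show (1 : ℝ[X]) ^ 2 + X ^ 2 - 1 = X ^ 2 by ring, one_mul, homLegendre_X_sq, one_pow, mul_one,
    Nat.add_sub_cancel_left, ← Algebra.smul_def, ← Algebra.smul_def, smul_smul, smul_smul,
    smul_smul, homLegendreCoeff_add, normFactor_mul_legendreDerivCoeff]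

/-- The expansion of a product of derivatives of Legendre polynomials. -/
lemma homLegendre_product {S : Type*} [CommRing S] [Algebra ℝ S] (m d : ℕ) (t z : S) :
    (normFactor m d : ℝ) • (homLegendre m d t 1 * homLegendre m d z 1) =
      ∑ k ∈ Finset.range (d / 2 + 1), (coeffUU (m + d) m k : ℝ) •
        homLegendre m (d - 2 * k) (t * z) (t ^ 2 + z ^ 2 - 1) := by
  -- The identity is proved for independent variables `T = X + 1` and `Z = C X`; `φ` evaluates at `T
  -- = 1`, and `ψ` specializes to `t, z`.
  have hDT : outerDerivative (X + 1) = 1 := by simp [outerDerivative_apply]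
  have hDZ : outerDerivative (C X) = 0 := by simp [outerDerivative_apply]
  have hET : innerDerivative (X + 1) = 0 := by
    ext1 j
    rw [coeff_innerDerivative, coeff_add, coeff_X, coeff_one]
    split_ifs <;> simp
  have hEZ : innerDerivative (C X) = 1 := by
    ext1 j
    rw [coeff_innerDerivative, coeff_C, coeff_one]
    split_ifs <;> simp
  obtain ⟨φ, hφ⟩ : ∃ φ : ℝ[X][X] →ₐ[ℝ] ℝ[X], ∀ G, φ G = G.coeff 0 :=
    ⟨(aeval (R := ℝ[X]) (0 : ℝ[X])).restrictScalars ℝ, fun G => (coeff_zero_eq_aeval_zero G).symm⟩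
  obtain ⟨ψ, hψT, hψZ⟩ : ∃ ψ : ℝ[X][X] →ₐ[ℝ] S, ψ (X + 1) = t ∧ ψ (C X) = z :=
    ⟨eval₂AlgHom (aeval z) (t - 1) fun a => Commute.all _ _, by simp, by simp⟩
  have h := eq_zero_of_gegenbauerOp_eq m _ (gegenbauerOp_product_sub m d _ _ _ _ hDT hDZ hET hEZ
    (normFactor m d) (Finset.range (d / 2 + 1)) (fun k => coeffUU (m + d) m k)
    (fun k => d - 2 * k)) (by
      rw [← hφ, map_product_sub, hφ, hφ]
      simpa [sub_eq_zero] using homLegendre_product_axis m d)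
  have h' := congrArg ψ h
  rwa [map_product_sub, hψT, hψZ, map_zero, sub_eq_zero] at h'

/-! ### Spheroidal coordinates -/

/-- With `s = sinh w`, `c = cos θ`, the numbers `τ²s²` and `-τ²c²` are the roots of `λ² - Dλ - τ²α²
= 0`, whose discriminant is `Δ²`. -/
lemma exists_elliptic_coord {α β τ : ℝ} (hα : 0 ≤ α) (hβ : 0 ≤ β) (hτ : 0 < τ) :
    ∃ θ w : ℝ, 0 ≤ θ ∧ θ ≤ Real.pi / 2 ∧ 0 ≤ w ∧
      α = τ * Real.cos θ * Real.sinh w ∧ β = τ * Real.sin θ * Real.cosh w := by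
  set D := α ^ 2 + β ^ 2 - τ ^ 2 with hD
  set Δ := Real.sqrt (D ^ 2 + 4 * τ ^ 2 * α ^ 2) with hΔ
  have hΔ2 : Δ ^ 2 = D ^ 2 + 4 * τ ^ 2 * α ^ 2 := Real.sq_sqrt (by positivity)
  have hΔD : |D| ≤ Δ := Real.abs_le_sqrt (by nlinarith [sq_nonneg (τ * α)])
  have h1 : 0 ≤ (Δ + D) / 2 := by linarith [neg_abs_le D]
  have h2 : 0 ≤ (Δ - D) / 2 := by linarith [le_abs_self D]
  -- This is `c² ≤ 1`; it amounts to `α² ≤ D + τ² = α² + β²`.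
  have h3 : Δ ≤ 2 * τ ^ 2 + D := by
    refine Real.sqrt_le_iff.2 ⟨by nlinarith, ?_⟩
    nlinarith [sq_nonneg (τ * β)]
  set s := Real.sqrt ((Δ + D) / 2) / τ with hs
  set c := Real.sqrt ((Δ - D) / 2) / τ with hc
  have hs0 : 0 ≤ s := by positivity
  have hc0 : 0 ≤ c := by positivity
  have hs2 : τ ^ 2 * s ^ 2 = (Δ + D) / 2 := by
    rw [hs, div_pow, Real.sq_sqrt h1]
    field_simp
  have hc2 : τ ^ 2 * c ^ 2 = (Δ - D) / 2 := by
    rw [hc, div_pow, Real.sq_sqrt h2]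
    field_simp
  have hτ2 : 0 < τ ^ 2 := by positivity
  have hc1 : c ^ 2 ≤ 1 := by
    refine le_of_mul_le_mul_left ?_ hτ2
    linarith
  have hc1' : c ≤ 1 := by nlinarith
  refine ⟨Real.arccos c, Real.arsinh s, Real.arccos_nonneg _, Real.arccos_le_pi_div_two.2 hc0,
    Real.arsinh_nonneg_iff.2 hs0, ?_, ?_⟩
  · rw [Real.cos_arccos (by linarith) hc1', Real.sinh_arsinh,
      ← pow_left_inj₀ hα (by positivity) two_ne_zero]
    refine mul_left_cancel₀ hτ2.ne' ?_
    linear_combination (-(τ ^ 2 * s ^ 2)) * hc2 - ((Δ - D) / 2) * hs2 - (1 / 4) * hΔ2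
  · rw [Real.sin_arccos, Real.cosh_arsinh, ← pow_left_inj₀ hβ (by positivity) two_ne_zero,
      mul_pow, mul_pow, Real.sq_sqrt (by linarith), Real.sq_sqrt (by positivity)]
    refine mul_left_cancel₀ hτ2.ne' ?_
    linear_combination (τ ^ 2 + τ ^ 2 * s ^ 2) * hc2 - (τ ^ 2 - (Δ - D) / 2) * hs2 +
      (1 / 4) * hΔ2 - τ ^ 2 * hD

lemma exists_isSpheroidalCoord {μ : ℂ} (hμ : μ ∈ eccentricities) (h0 : μ ≠ 0) (a : ℝ) {ρ : ℝ}
    (hρ : 0 ≤ ρ) : ∃ p, IsSpheroidalCoord μ a ρ p := by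
  rcases hμ with ⟨him, hre, -⟩ | ⟨hre, him⟩
  · have hμ' : μ = (μ.re : ℂ) := Complex.ext rfl (by simpa using him)
    have hre' : 0 < μ.re := lt_of_le_of_ne hre fun h => h0 (by rw [hμ', ← h, Complex.ofReal_zero])
    -- Prolate case: the roles of axis and radius are exchanged, and `u = π/2 ∓ θ` according to the
    -- sign of `a`.
    obtain ⟨θ, w, hθ0, hθ1, hw, h1, h2⟩ := exists_elliptic_coord hρ (abs_nonneg a) hre'
    rcases le_total 0 a with ha | ha
    · rw [abs_of_nonneg ha] at h2
      refine ⟨(Real.pi / 2 - θ, (w : ℂ)), ⟨by simp; linarith, by simp; linarith [Real.pi_pos]⟩,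
        by simpa using hw, by simp [him], ?_, ?_⟩
      · rw [hμ', ← Complex.ofReal_cos, ← Complex.ofReal_cosh, Real.cos_pi_div_two_sub]
        exact_mod_cast h2
      · rw [hμ', ← Complex.ofReal_sin, ← Complex.ofReal_sinh, Real.sin_pi_div_two_sub]
        exact_mod_cast h1
    · rw [abs_of_nonpos ha] at h2
      refine ⟨(θ + Real.pi / 2, (w : ℂ)), ⟨by simp; linarith [Real.pi_pos], by simp; linarith⟩,
        by simpa using hw, by simp [him], ?_, ?_⟩
      · rw [hμ', ← Complex.ofReal_cos, ← Complex.ofReal_cosh, Real.cos_add_pi_div_two]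
        have : a = μ.re * -Real.sin θ * Real.cosh w := by linarith
        exact_mod_cast this
      · rw [hμ', ← Complex.ofReal_sin, ← Complex.ofReal_sinh, Real.sin_add_pi_div_two]
        exact_mod_cast h1
  · obtain ⟨τ, hτ, rfl⟩ : ∃ τ : ℝ, 0 < τ ∧ μ = τ * Complex.I :=
      ⟨μ.im, him, Complex.ext (by simpa using hre) (by simp)⟩
    obtain ⟨θ, w, hθ0, hθ1, hw, h1, h2⟩ := exists_elliptic_coord (abs_nonneg a) hρ hτ
    -- In the oblate case `v = w - iπ/2` produces a factor `-i` that cancels the `i` of `μ = iτ`.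
    have hcosh : Complex.cosh (w - Real.pi / 2 * Complex.I) = -(Complex.sinh w * Complex.I) := by
      rw [Complex.cosh_sub, Complex.cosh_mul_I, Complex.sinh_mul_I]
      simp
    have hsinh : Complex.sinh (w - Real.pi / 2 * Complex.I) = -(Complex.cosh w * Complex.I) := by
      rw [Complex.sinh_sub, Complex.cosh_mul_I, Complex.sinh_mul_I]
      simp
    have hv : (0 : ℝ) ≤ (w - Real.pi / 2 * Complex.I : ℂ).re := by simpa using hw
    have hv' : (w - Real.pi / 2 * Complex.I : ℂ).im =
        if (τ * Complex.I).im = 0 then 0 else -(Real.pi / 2) := by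
      rw [if_neg him.ne']
      simp
    rcases le_total 0 a with ha | ha
    · rw [abs_of_nonneg ha] at h1
      refine ⟨(θ, w - Real.pi / 2 * Complex.I), ⟨hθ0, by linarith⟩, hv, hv', ?_, ?_⟩
      · rw [hcosh, h1]
        push_cast
        linear_combination ((τ : ℂ) * Complex.cos θ * Complex.sinh w) * Complex.I_sq
      · rw [hsinh, h2]
        push_cast
        linear_combination ((τ : ℂ) * Complex.sin θ * Complex.cosh w) * Complex.I_sq
    · rw [abs_of_nonpos ha] at h1
      have h1' : a = -(τ * Real.cos θ * Real.sinh w) := by linarith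
      refine ⟨(Real.pi - θ, w - Real.pi / 2 * Complex.I), ⟨by simp; linarith, by simpa using hθ0⟩,
        hv, hv', ?_, ?_⟩
      · rw [hcosh, ← Complex.ofReal_cos, Real.cos_pi_sub, h1']
        push_cast
        simp
        linear_combination (-τ * Complex.cos θ * Complex.sinh w) * Complex.I_sq
      · rw [hsinh, ← Complex.ofReal_sin, Real.sin_pi_sub, h2]
        push_cast
        simp
        linear_combination ((τ : ℂ) * Complex.sin θ * Complex.cosh w) * Complex.I_sq

/-! ### Solid harmonics as polynomials -/

lemma aeval_iterate_derivative_legendre {S : Type*} [CommRing S] [Algebra ℝ S] (m d : ℕ) (t : S) :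
    aeval t (derivative^[m] (legendre (m + d))) = homLegendre m d t 1 := by
  rw [iterate_derivative_legendre, map_homLegendre, aeval_X, map_one]

lemma assocLegendre_add (m d : ℕ) (t : ℝ) :
    assocLegendre (m + d) m t = (-1) ^ m * Real.sqrt (1 - t ^ 2) ^ m * homLegendre m d t 1 := by
  rw [assocLegendre, ← aeval_iterate_derivative_legendre, coe_aeval_eq_eval]

lemma UHat_zero_of_lt {n m : ℕ} (h : n < m) (a ρ : ℝ) : UHat n m 0 a ρ = 0 := by
  simp [UHat, assocLegendre, iterate_derivative_legendre_of_lt h]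

lemma UHat_zero (m d : ℕ) (a : ℝ) {ρ : ℝ} (hρ : 0 ≤ ρ) :
    UHat (m + d) m 0 a ρ = ((-1) ^ m * ρ ^ m * homLegendre m d a (a ^ 2 + ρ ^ 2) : ℝ) := by
  rw [UHat, if_pos rfl, assocLegendre_add]
  congr 1
  set r := Real.sqrt (a ^ 2 + ρ ^ 2) with hr
  have hr2 : r ^ 2 = a ^ 2 + ρ ^ 2 := Real.sq_sqrt (by positivity)
  rcases eq_or_lt_of_le (Real.sqrt_nonneg (a ^ 2 + ρ ^ 2)) with h0 | h0
  · have hr0 : r = 0 := h0.symm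
    rw [hr0] at hr2
    have ha : a = 0 := by nlinarith [sq_nonneg ρ]
    have hρ0 : ρ = 0 := by nlinarith [sq_nonneg a]
    rw [hr0, ha, hρ0]
    rcases m with _ | m
    -- At the origin `a / r` is `0 / 0 = 0`; homogeneity with factor `0` settles this case.
    · have := homLegendre_smul 0 d (0 : ℝ) 0 1
      simp only [zero_mul, ne_eq, OfNat.ofNat_ne_zero, not_false_eq_true, zero_pow] at this
      simp [this]
    · simp
  · have hr0 : r ≠ 0 := h0.ne'
    have h1 : Real.sqrt (1 - (a / r) ^ 2) = ρ / r := by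
      rw [Real.sqrt_eq_iff_eq_sq (by
        rw [div_pow, sub_nonneg, div_le_one (by positivity), hr2]
        nlinarith [sq_nonneg ρ]) (by positivity)]
      field_simp
      linarith
    have h2 := homLegendre_smul m d r (a / r) 1
    rw [mul_div_cancel₀ a hr0, mul_one, hr2] at h2
    rw [h1, h2, pow_add, div_pow]
    field_simp

lemma UHat_zero' (m d : ℕ) (a : ℝ) {ρ : ℝ} (hρ : 0 ≤ ρ) :
    UHat (m + d) m 0 a ρ =
      (-1) ^ m * (ρ : ℂ) ^ m * homLegendre m d (a : ℂ) ((a : ℂ) ^ 2 + (ρ : ℂ) ^ 2) := by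
  rw [UHat_zero m d a hρ]
  have := map_homLegendre Complex.ofRealAm m d a (a ^ 2 + ρ ^ 2)
  simp only [Complex.ofRealAm_coe, Complex.ofReal_add, Complex.ofReal_pow] at this
  rw [← this]
  push_cast
  rfl

lemma UCoord_eq {m d : ℕ} {μ : ℂ} {a ρ : ℝ} {p : ℝ × ℂ} (hp : IsSpheroidalCoord μ a ρ p) :
    UCoord (m + d) m μ p.1 p.2 =
      ∑ k ∈ Finset.range (d / 2 + 1), (coeffUU (m + d) m k : ℂ) * μ ^ (2 * k) *
        ((-1) ^ m * (ρ : ℂ) ^ m *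
          homLegendre m (d - 2 * k) (a : ℂ) ((a : ℂ) ^ 2 + (ρ : ℂ) ^ 2)) := by
  obtain ⟨u, v⟩ := p
  obtain ⟨⟨hu0, hu1⟩, -, -, ha, hρ⟩ := hp
  dsimp only at *
  have hsin : Real.sqrt (1 - Real.cos u ^ 2) = Real.sin u := by
    rw [← Real.sin_sq, Real.sqrt_sq (Real.sin_nonneg_of_nonneg_of_le_pi hu0 hu1)]
  have hprod := homLegendre_product m d (Complex.cos u) (Complex.cosh v)
  have hcast := map_homLegendre Complex.ofRealAm m d (Real.cos u) 1
  simp only [Complex.ofRealAm_coe, Complex.ofReal_cos, Complex.ofReal_one] at hcast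
  have hQ : (a : ℂ) ^ 2 + (ρ : ℂ) ^ 2 =
      μ ^ 2 * (Complex.cos u ^ 2 + Complex.cosh v ^ 2 - 1) := by
    rw [ha, hρ, mul_pow, mul_pow, mul_pow, mul_pow, Complex.sin_sq, Complex.sinh_sq]
    ring
  have hA : (a : ℂ) = μ * (Complex.cos u * Complex.cosh v) := by rw [ha]; ring
  rw [UCoord, assocLegendreCosh, aeval_iterate_derivative_legendre, assocLegendre_add, hsin,
    Nat.add_sub_cancel_left]
  change ((normFactor m d : ℚ) : ℂ) * _ * _ * _ = _
  calc _ = (-1) ^ m * (ρ : ℂ) ^ m * μ ^ d * ((normFactor m d : ℝ) •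
        (homLegendre m d (Complex.cos u) 1 * homLegendre m d (Complex.cosh v) 1)) := by
        rw [hρ, ← hcast, Complex.real_smul]
        push_cast
        ring
    _ = _ := by
        rw [hprod, Finset.mul_sum]
        refine Finset.sum_congr rfl fun k hk => ?_
        rw [Finset.mem_range] at hk
        rw [hQ, hA, homLegendre_smul, Complex.real_smul]
        obtain ⟨e, rfl⟩ := Nat.exists_eq_add_of_le (by omega : 2 * k ≤ d)
        rw [Nat.add_sub_cancel_left]
        push_cast
        ring

lemma coeffUU_zero {n m : ℕ} (h : m ≤ n) : coeffUU n m 0 = 1 := by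
  rw [coeffUU, if_pos (by omega)]
  have : rising (1 / 2) n ≠ 0 := by
    rw [rising_half]
    positivity
  simp only [Nat.sub_zero, mul_zero, pow_zero, Nat.factorial_zero, Nat.cast_one, one_mul, mul_one]
  rw [show rising _ 0 = 1 by simp [rising], mul_one, div_self this]

/-- The expansion of a spheroidal harmonic in solid spherical harmonics. -/
lemma UHat_eq_sum {μ : ℂ} (hμ : μ ∈ eccentricities) (m d : ℕ) (a : ℝ) {ρ : ℝ} (hρ : 0 ≤ ρ) :
    UHat (m + d) m μ a ρ =
      ∑ k ∈ Finset.range (d / 2 + 1), (coeffUU (m + d) m k : ℂ) * μ ^ (2 * k) *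
        UHat (m + (d - 2 * k)) m 0 a ρ := by
  by_cases h0 : μ = 0
  · subst h0
    -- For `μ = 0` only `k = 0` survives, with coefficient `1`.
    rw [Finset.sum_eq_single_of_mem 0 (by simp) fun k _ hk => by simp [hk]]
    simp [coeffUU_zero]
  · simp only [UHat_zero' m _ a hρ]
    rw [UHat, if_neg h0]
    -- Existence of coordinates suffices: `UCoord_eq` holds for every admissible choice.
    exact UCoord_eq (Classical.epsilon_spec (exists_isSpheroidalCoord hμ h0 a hρ))

/-! ### Derivatives along the axis -/

lemma hasDerivAt_UHat_zero (m d : ℕ) (a : ℝ) {ρ : ℝ} (hρ : 0 ≤ ρ) :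
    HasDerivAt (fun t => UHat (m + (d + 1)) m 0 t ρ)
      ((2 * m + d + 1) * UHat (m + d) m 0 a ρ) a := by
  simp only [UHat_zero m _ _ hρ]
  have key : ∀ e (t : ℝ), homLegendre m e t (t ^ 2 + ρ ^ 2) =
      eval t (homLegendre m e X (X ^ 2 + C (ρ ^ 2))) := by
    intro e t
    rw [← coe_aeval_eq_eval, map_homLegendre]
    simp
  have h := derivation_homLegendre_succ (derivative' (R := ℝ)) m d X (X ^ 2 + C (ρ ^ 2)) (by simp)
    (by
      rw [map_add, derivative'_apply, derivative'_apply, derivative_C, derivative_X_sq, add_zero]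
      rfl)
  have h1 := ((homLegendre m (d + 1) X (X ^ 2 + C (ρ ^ 2)) : ℝ[X]).hasDerivAt a).const_mul
    ((-1) ^ m * ρ ^ m)
  rw [show derivative (homLegendre m (d + 1) X (X ^ 2 + C (ρ ^ 2)) : ℝ[X]) = _ from h] at h1
  simp only [key]
  convert h1.ofReal_comp using 1
  simp
  ring

/-- For `d = 0` the polynomial `H_0` is constant, so only `ρ^m` remains. -/
lemma hasDerivAt_UHat_zero_self (m : ℕ) (a : ℝ) {ρ : ℝ} (hρ : 0 ≤ ρ) :
    HasDerivAt (fun t => UHat m m 0 t ρ) 0 a := by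
  have h := fun t => UHat_zero m 0 t hρ
  simp only [add_zero] at h
  simp only [h]
  simpa [homLegendre] using hasDerivAt_const a _

lemma hasDerivAt_UHat {μ : ℂ} (hμ : μ ∈ eccentricities) {n m : ℕ} (hm : m ≤ n) (a : ℝ) {ρ : ℝ}
    (hρ : 0 ≤ ρ) :
    HasDerivAt (fun t => UHat (n + 1) m μ t ρ)
      (∑ k ∈ Finset.range ((n - m + 1) / 2 + 1),
        (coeffUV n m k : ℂ) * μ ^ (2 * k) * UHat (n - 2 * k) m 0 a ρ) a := by
  obtain ⟨d, rfl⟩ := Nat.exists_eq_add_of_le hm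
  simp only [add_assoc m d 1, UHat_eq_sum hμ m (d + 1) _ hρ, Nat.add_sub_cancel_left]
  refine HasDerivAt.fun_sum fun k hk => ?_
  rw [Finset.mem_range] at hk
  rw [coeffUV, coeffVV, add_assoc m d 1]
  rcases (by omega : 2 * k ≤ d ∨ 2 * k = d + 1) with h | h
  · obtain ⟨e, rfl⟩ := Nat.exists_eq_add_of_le h
    rw [show 2 * k + e + 1 - 2 * k = e + 1 by omega, show m + (2 * k + e) - 2 * k = m + e by omega]
    refine ((hasDerivAt_UHat_zero m e a hρ).const_mul _).congr_deriv ?_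
    push_cast
    ring
  · rw [h, Nat.sub_self, add_zero]
    refine ((hasDerivAt_UHat_zero_self m a hρ).const_mul _).congr_deriv ?_
    -- The extra term `2k = n-m+1`: for `m = 0` the factor `n+m-2k+1` vanishes, so the truncated
    -- index `n - 2k = 0` is harmless; for `m ≥ 1` the degree is `m - 1`.
    rcases m with _ | m
    · have : ((0 + d : ℕ) : ℚ) + (0 : ℕ) - 2 * k + 1 = 0 := by
        have : (2 : ℚ) * k = d + 1 := by exact_mod_cast h
        rw [this]
        push_cast
        ring
      rw [this]
      simp
    · rw [UHat_zero_of_lt (by omega)]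
      simp

lemma axisDist_nonneg (x : R3) : 0 ≤ axisDist x := Real.sqrt_nonneg _

lemma hasLineDerivAt_U {μ : ℂ} (hμ : μ ∈ eccentricities) {n m : ℕ} (hm : m ≤ n) (s : Kind)
    (x : R3) :
    HasLineDerivAt ℝ (U s (n + 1) m μ)
      ((∑ k ∈ Finset.range ((n - m + 1) / 2 + 1), (coeffUV n m k : ℂ) * μ ^ (2 * k) *
        UHat (n - 2 * k) m 0 (x 0) (axisDist x)) * angular s m (azimuth x)) x e0 := by
  -- Translation along the axis fixes `ρ` and the azimuth, so only the meridian factor is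
  -- differentiated.
  have h0 : ∀ t : ℝ, (x + t • e0) 0 = x 0 + t := fun t => by simp [e0]
  have h1 : ∀ t : ℝ, (x + t • e0) 1 = x 1 := fun t => by simp [e0]
  have h2 : ∀ t : ℝ, (x + t • e0) 2 = x 2 := fun t => by simp [e0]
  have h := (hasDerivAt_UHat hμ hm (x 0 + 0) (axisDist_nonneg x)).comp_const_add
    (x 0) 0
  rw [add_zero] at h
  simp only [HasLineDerivAt, U, axisDist, azimuth, h0, h1, h2]
  exact h.mul_const _

lemma V_eq {μ : ℂ} (hμ : μ ∈ eccentricities) {n m : ℕ} (hm : m ≤ n) (s : Kind) (x : R3) :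
    V s n m μ x =
      (∑ k ∈ Finset.range ((n - m + 1) / 2 + 1), (coeffUV n m k : ℂ) * μ ^ (2 * k) *
        UHat (n - 2 * k) m 0 (x 0) (axisDist x)) * angular s m (azimuth x) :=
  (hasLineDerivAt_U hμ hm s x).lineDeriv

lemma VHat_eq {μ : ℂ} (hμ : μ ∈ eccentricities) {n m : ℕ} (hm : m ≤ n) (a : ℝ) {ρ : ℝ}
    (hρ : 0 ≤ ρ) :
    VHat n m μ a ρ =
      ∑ k ∈ Finset.range ((n - m + 1) / 2 + 1),
        (coeffUV n m k : ℂ) * μ ^ (2 * k) * UHat (n - 2 * k) m 0 a ρ := by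
  have h1 : axisDist !₂[a, ρ, 0] = ρ := by simp [axisDist, Real.sqrt_sq hρ]
  -- Also valid for `ρ = 0`, since `arg 0 = 0`.
  have h2 : azimuth !₂[a, ρ, 0] = 0 :=
    Complex.arg_ofReal_of_nonneg hρ
  rw [VHat, V_eq hμ hm, h1, h2]
  simp [angular]

end Spheroidal

end

open Spheroidal in
/-- The index set is `0 ≤ 2k ≤ n - m + 1`. The term `2k = n - m + 1`, if present, is zero:
`U_{m-1,m}[0] = 0` for `m ≥ 1`, and the coefficient is zero for `m = 0`. -/
theorem mainTheorem7 (n m : ℕ) (hm : m ≤ n) (μ : ℂ) (hμ : μ ∈ eccentricities) :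
    (∀ a ρ : ℝ, 0 ≤ ρ →
      VHat n m μ a ρ =
        ∑ k ∈ Finset.range ((n - m + 1) / 2 + 1),
          (coeffUV n m k : ℂ) * μ ^ (2 * k) * UHat (n - 2 * k) m 0 a ρ) ∧
    (∀ s : Kind, (s = Kind.minus → 1 ≤ m) → ∀ x : R3,
      LineDifferentiableAt ℝ (U s (n + 1) m μ) x e0 ∧
      V s n m μ x = VHat n m μ (x 0) (axisDist x) * angular s m (azimuth x) ∧
      V s n m μ x =
        ∑ k ∈ Finset.range ((n - m + 1) / 2 + 1),
          (coeffUV n m k : ℂ) * μ ^ (2 * k) * U s (n - 2 * k) m 0 x) := by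
  refine ⟨fun a ρ hρ => VHat_eq hμ hm a hρ, fun s _ x =>
    ⟨(hasLineDerivAt_U hμ hm s x).lineDifferentiableAt, ?_, ?_⟩⟩
  · rw [V_eq hμ hm, VHat_eq hμ hm _ (axisDist_nonneg x)]
  · simp only [V_eq hμ hm, U, Finset.sum_mul, mul_assoc]
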